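/- Let $G$ be a finite simple graph on $n\ge 1$ vertices whose edges are colored arbitrarily. Let $e(G)$ be the number of edges of $G$ and $c(G)$ the number of colors appearing on them. A properly colored $C_4$ is a 4-cycle in $G$ in which any two adjacent edges have distinct colors. (a) If $e(G)+c(G)\ge \frac{n(n+1)}{2}+1$, then $G$ contains a properly colored $C_4$. (b) If $e(G)+c(G)=\frac{n(n+1)}{2}$ and $G$ contains no properly colored $C_4$, then $G$ is complete, and $G$ contains at least one of the following: (1) a vertex with all incident edges in a single color; (2) a rainbow triangle $uvw$, say with $uv$ red, $vw$ blue and $uw$ green (three distinct colors), such that all other edges at $u$ are red, all other edges at $v$ are blue and all other edges at $w$ are green; (3) a vertex whose incident edges have pairwise distinct colors, while all other edges of $G$ have a single color, distinct from those at the vertex. Moreover, the structure is layered: starting from $G$, one can repeatedly delete a vertex as in (1) or the three vertices of a triangle as in (2) (with respect to the current induced subgraph), zero or more times, until a complete graph of type (3) remains, where at every stage, including the first and the last, the number of colors appearing on the current complete graph equals its number of vertices. -/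

import Mathlib

/-! An edge-colored graph is a simple graph `G` on `V` with `C : G.EdgeLabeling K`, an arbitrary
assignment of colors in `K` to the edges of `G`.  `(C.labelGraph k).Adj x y` says that `xy` is an
edge of `G` and that its color is `k`. -/

namespace SimpleGraph.EdgeLabeling

variable {V K : Type*} {G : SimpleGraph V}

/-- `c(G)`: the number of colors that appear on the edges of `G`. -/
noncomputable def numColors (C : G.EdgeLabeling K) : ℕ :=
  {k : K | ∃ e : G.edgeSet, C e = k}.ncard

/-- The number of colors that appear on the edges of `G` with both ends in `S`. -/
noncomputable def numColorsOn (C : G.EdgeLabeling K) (S : Set V) : ℕ :=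
  {k : K | ∃ x ∈ S, ∃ y ∈ S, (C.labelGraph k).Adj x y}.ncard

/-- `G` contains a properly colored `C₄`: a cycle `a b c d a` of `G` on four distinct vertices in
which any two adjacent edges have distinct colors.  (Neighbors on the cycle are distinct because
they are adjacent.) -/
def HasProperlyColoredC4 (C : G.EdgeLabeling K) : Prop :=
  ∃ a b c d : V, a ≠ c ∧ b ≠ d ∧ ∃ p q r s : K,
    (C.labelGraph p).Adj a b ∧ (C.labelGraph q).Adj b c ∧
    (C.labelGraph r).Adj c d ∧ (C.labelGraph s).Adj d a ∧
    p ≠ q ∧ q ≠ r ∧ r ≠ s ∧ s ≠ p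

/-- In the complete graph induced on `S`, all edges at the vertex `v` have a single color. -/
def IsMonochromaticVertex (C : G.EdgeLabeling K) (S : Set V) (v : V) : Prop :=
  v ∈ S ∧ ∃ k : K, ∀ x ∈ S, x ≠ v → (C.labelGraph k).Adj v x

/-- In the complete graph induced on `S`, `uvw` is a rainbow triangle with `uv` red, `vw` blue and
`uw` green, all other edges at `u` are red, all other edges at `v` are blue, and all other edges
at `w` are green. -/
def IsDominatingRainbowTriangle (C : G.EdgeLabeling K) (S : Set V) (u v w : V) : Prop :=
  u ∈ S ∧ v ∈ S ∧ w ∈ S ∧ ∃ red blue green : K,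
    red ≠ blue ∧ blue ≠ green ∧ red ≠ green ∧
    (C.labelGraph red).Adj u v ∧ (C.labelGraph blue).Adj v w ∧ (C.labelGraph green).Adj u w ∧
    ∀ x ∈ S, x ≠ u → x ≠ v → x ≠ w →
      (C.labelGraph red).Adj u x ∧ (C.labelGraph blue).Adj v x ∧ (C.labelGraph green).Adj w x

/-- In the complete graph induced on `S`, the edges at `v` have pairwise distinct colors, and all
other edges have a single color `k`, which does not appear at `v`. -/
def IsRainbowStarCenter (C : G.EdgeLabeling K) (S : Set V) (v : V) : Prop :=
  v ∈ S ∧ ∃ k : K,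
    (∀ x ∈ S, x ≠ v → ∃ a : K, a ≠ k ∧ (C.labelGraph a).Adj v x) ∧
    (∀ x ∈ S, ∀ y ∈ S, ∀ a : K,
      (C.labelGraph a).Adj v x → (C.labelGraph a).Adj v y → x = y) ∧
    (∀ x ∈ S, ∀ y ∈ S, x ≠ v → y ≠ v → x ≠ y → (C.labelGraph k).Adj x y)

/-- The layered structure of the complete graph induced on `S`: at each stage the number of colors
equals the number of vertices, and either all of the stage is the central rainbow star with its
monochromatic rest (for three vertices, a rainbow triangle), or an outer layer, which is a
monochromatic vertex or a dominating rainbow triangle, is removed and what remains is again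
layered. -/
inductive IsLayered (C : G.EdgeLabeling K) : Set V → Prop
  | center (S : Set V) (v : V) (hcard : C.numColorsOn S = S.ncard)
      (h : C.IsRainbowStarCenter S v) : IsLayered C S
  | vertex (S : Set V) (v : V) (hcard : C.numColorsOn S = S.ncard)
      (h : C.IsMonochromaticVertex S v) (hrest : IsLayered C (S \ {v})) : IsLayered C S
  | triangle (S : Set V) (u v w : V) (hcard : C.numColorsOn S = S.ncard)
      (h : C.IsDominatingRainbowTriangle S u v w) (hrest : IsLayered C (S \ {u, v, w})) :
      IsLayered C S

end SimpleGraph.EdgeLabeling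

open Finset

set_option linter.unusedSectionVars false

/-! Call a color saturated at `v` if all its edges meet `v`. `weight` is twice the number of edges
plus colors, and deleting `v` lowers it by `2 * (deg v + sat v)`. If some vertex of an `n`-vertex
set has `deg + sat ≤ n`, the bound `n * (n + 1)` follows by induction.

Otherwise every vertex has `deg + sat ≥ n + 1`, hence at least two saturated colors. If `va` and
`vb` carry two of them, a cycle `v a w b` forces `aw` and `bw` to agree in color (`NoC4.color_eq`).
Counting non-neighbors of `b` then shows that `v`, `a`, `b` span a triangle whose colors occur
nowhere else, and that the graph is complete. Such a triangle passes through every vertex, and a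
vertex off a given one yields a properly colored 4-cycle. So the graph is a single rainbow triangle
(`NoC4.rainbow_triangle`), where the bound is attained.

For equality, either the graph is this triangle, or some `v` has `deg + sat = n` and the graph
without `v` is again extremal, so by induction it is complete and of one of the three types. Each
type is extended by `v` separately (`Extension.of_mono`, `of_star`, `of_dom`). Completeness always
comes from a vertex with at most one saturated color: it must be joined to everything, and deleting
it leaves an extremal graph. The layers follow because an outer layer accounts for exactly as many
colors as vertices. -/

/-- An edge-colored graph, given by the color of each pair of vertices (`none` for a non-edge). -/
structure PartialColoring (V K : Type*) where
  color : V → V → Option K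
  symm : ∀ x y, color x y = color y x
  irrefl : ∀ x, color x x = none

namespace PartialColoring

/-! ### Degrees, saturated colors and vertex deletion -/

variable {V K : Type*} [DecidableEq V] [DecidableEq K] (G : PartialColoring V K)

/-- The degree of `v` in the subgraph induced on `S`. -/
def deg (S : Finset V) (v : V) : ℕ := #{x ∈ S | (G.color v x).isSome}

/-- The colors on the subgraph induced on `S`. -/
def cols (S : Finset V) : Finset K := ((S ×ˢ S).image fun p => G.color p.1 p.2).eraseNone

/-- The colors on the subgraph induced on `S` all of whose edges are incident with `v`. -/
def sat (S : Finset V) (v : V) : Finset K := G.cols S \ G.cols (S.erase v)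

/-- Twice the number of edges plus twice the number of colors on `S`. -/
def weight (S : Finset V) : ℕ := ∑ x ∈ S, G.deg S x + 2 * #(G.cols S)

/-- There is no properly colored 4-cycle. -/
def NoC4 : Prop := ∀ a b x y p q r s, a ≠ x → b ≠ y → G.color a b = some p →
  G.color b x = some q → G.color x y = some r → G.color y a = some s →
  p = q ∨ q = r ∨ r = s ∨ s = p

/-- `S` induces a complete graph. -/
def Complete (S : Finset V) : Prop := ∀ x ∈ S, ∀ y ∈ S, x ≠ y → ∃ k, G.color x y = some k

variable {G} {S : Finset V} {v : V}

theorem ne_of_color {x y : V} {k : K} (h : G.color x y = some k) : x ≠ y := by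
  rintro rfl; simp [G.irrefl] at h

theorem color_comm {x y : V} {k : K} (h : G.color x y = some k) : G.color y x = some k := by
  rw [G.symm]; exact h

theorem mem_cols {k : K} : k ∈ G.cols S ↔ ∃ x ∈ S, ∃ y ∈ S, G.color x y = some k := by
  simp only [cols, mem_eraseNone, mem_image, mem_product, Prod.exists]
  exact ⟨fun ⟨x, y, h, e⟩ => ⟨x, h.1, y, h.2, e⟩, fun ⟨x, hx, y, hy, e⟩ => ⟨x, y, ⟨hx, hy⟩, e⟩⟩

theorem cols_mono {T : Finset V} (h : T ⊆ S) : G.cols T ⊆ G.cols S := by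
  intro k hk
  obtain ⟨x, hx, y, hy, e⟩ := mem_cols.1 hk
  exact mem_cols.2 ⟨x, h hx, y, h hy, e⟩

theorem exists_of_mem_sat {k : K} (h : k ∈ G.sat S v) : ∃ x ∈ S, G.color v x = some k := by
  obtain ⟨h1, h2⟩ := mem_sdiff.1 h
  obtain ⟨x, hx, y, hy, e⟩ := mem_cols.1 h1
  by_cases hxv : x = v
  · exact ⟨y, hy, hxv ▸ e⟩
  by_cases hyv : y = v
  · exact ⟨x, hx, hyv ▸ color_comm e⟩
  exact absurd (mem_cols.2 ⟨x, mem_erase.2 ⟨hxv, hx⟩, y, mem_erase.2 ⟨hyv, hy⟩, e⟩) h2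

theorem sat_not {k : K} (h : k ∈ G.sat S v) {x y : V} (hx : x ∈ S) (hy : y ∈ S) (hxv : x ≠ v)
    (hyv : y ≠ v) : G.color x y ≠ some k := fun e =>
  (mem_sdiff.1 h).2 (mem_cols.2 ⟨x, mem_erase.2 ⟨hxv, hx⟩, y, mem_erase.2 ⟨hyv, hy⟩, e⟩)

theorem deg_erase (hv : v ∈ S) (x : V) :
    G.deg S x = G.deg (S.erase v) x + if (G.color x v).isSome then 1 else 0 := by
  conv_lhs => rw [← insert_erase hv]
  unfold deg
  rw [filter_insert]
  split_ifs
  · rw [card_insert_of_notMem (by simp)]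
  · rfl

theorem deg_erase_self : G.deg (S.erase v) v = G.deg S v := by
  by_cases hv : v ∈ S
  · rw [deg_erase hv v]; simp [G.irrefl]
  · rw [erase_eq_of_notMem hv]

theorem card_cols_erase : #(G.cols S) = #(G.cols (S.erase v)) + #(G.sat S v) := by
  rw [sat, add_comm, card_sdiff_add_card_eq_card (cols_mono (erase_subset _ _))]

theorem weight_erase (hv : v ∈ S) :
    G.weight S = G.weight (S.erase v) + 2 * (G.deg S v + #(G.sat S v)) := by
  have h : ∑ x ∈ S, G.deg S x = ∑ x ∈ S.erase v, G.deg (S.erase v) x + 2 * G.deg S v := by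
    rw [← add_sum_erase _ _ hv, sum_congr rfl fun x _ => deg_erase hv x, sum_add_distrib,
      ← card_filter]
    have : #{x ∈ S.erase v | (G.color x v).isSome} = G.deg S v := by
      rw [← deg_erase_self, deg]; simp_rw [G.symm v]
    omega
  rw [weight, weight, h, card_cols_erase (v := v)]; ring

theorem card_nonadj (hv : v ∈ S) :
    #{x ∈ S.erase v | G.color v x = none} + G.deg S v + 1 = #S := by
  rw [← deg_erase_self, deg, ← card_erase_add_one hv,
    ← card_filter_add_card_filter_not (s := S.erase v) (fun x => G.color v x = none)]
  simp [Option.isSome_iff_ne_none]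

theorem deg_lt (hv : v ∈ S) : G.deg S v + 1 ≤ #S := by
  have := card_nonadj (G := G) hv; omega

theorem sum_deg_le : ∑ x ∈ S, G.deg S x + #S ≤ #S * #S := by
  calc _ = ∑ x ∈ S, (G.deg S x + 1) := by simp [sum_add_distrib]
    _ ≤ ∑ x ∈ S, #S := sum_le_sum fun x hx => deg_lt hx
    _ = _ := by simp

theorem adj_of_deg (hv : v ∈ S) (h : #S ≤ G.deg S v + 1) {x : V} (hx : x ∈ S) (hxv : x ≠ v) :
    ∃ k, G.color v x = some k := by
  have := card_nonadj (G := G) hv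
  have h0 : #{x ∈ S.erase v | G.color v x = none} = 0 := by omega
  rw [card_eq_zero, filter_eq_empty_iff] at h0
  exact Option.ne_none_iff_exists'.1 (h0 (mem_erase.2 ⟨hxv, hx⟩))

theorem Complete.deg_eq (h : G.Complete S) (hv : v ∈ S) : G.deg S v + 1 = #S := by
  rw [← card_nonadj (G := G) hv, (card_eq_zero (s := filter _ _)).2, zero_add]
  rw [filter_eq_empty_iff]
  intro x hx e
  obtain ⟨k, hk⟩ := h v hv x (mem_of_mem_erase hx) (ne_of_mem_erase hx).symm
  simp [hk] at e

theorem Complete.weight_eq (h : G.Complete S) : G.weight S + #S = #S * #S + 2 * #(G.cols S) := by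
  have : ∑ x ∈ S, G.deg S x + #S = #S * #S := by
    calc _ = ∑ x ∈ S, (G.deg S x + 1) := by simp [sum_add_distrib]
      _ = ∑ x ∈ S, #S := sum_congr rfl fun x hx => h.deg_eq hx
      _ = _ := by simp
  rw [weight]; omega

theorem Complete.mono {T : Finset V} (h : G.Complete S) (hT : T ⊆ S) : G.Complete T :=
  fun x hx y hy => h x (hT hx) y (hT hy)

/-! ### Graphs in which every deletion is expensive -/

/-- Two neighbors of `v` along distinct saturated colors of `v` see every other vertex in the
same color. -/
theorem NoC4.color_eq (hG : G.NoC4) {k l : K} (hk : k ∈ G.sat S v) (hl : l ∈ G.sat S v)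
    (hkl : k ≠ l) {a b w : V} (ha : a ∈ S) (hb : b ∈ S) (hw : w ∈ S) (hva : G.color v a = some k)
    (hvb : G.color v b = some l) (hwv : w ≠ v) {p q : K} (haw : G.color a w = some p)
    (hbw : G.color b w = some q) : p = q := by
  have hab : a ≠ b := by rintro rfl; rw [hva] at hvb; exact hkl (Option.some.inj hvb)
  have hav := (ne_of_color hva).symm
  have hbv := (ne_of_color hvb).symm
  rcases hG v a w b k p q l hwv.symm hab hva haw (color_comm hbw) (color_comm hvb)
    with h | h | h | h
  · exact absurd haw (h ▸ sat_not hk ha hw hav hwv)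
  · exact h
  · exact absurd hbw (h ▸ sat_not hl hb hw hbv hwv)
  · exact absurd h.symm hkl

/-- The vertices joined to `v` by an edge in a saturated color of `v`. -/
def satNbrs (G : PartialColoring V K) (S : Finset V) (v : V) : Finset V :=
  {x ∈ S | ∃ k ∈ G.sat S v, G.color v x = some k}

/-- Pigeonhole: an edge from `v` to a given vertex has only one color. -/
theorem card_sat_le {P : Finset V} (hP : ∀ k ∈ G.sat S v, ∃ x ∈ P, G.color v x = some k) :
    #(G.sat S v) ≤ #P := by
  rw [← card_map (s := G.sat S v) Function.Embedding.some]
  refine (card_le_card fun o ho => ?_).trans (card_image_le (s := P) (f := G.color v))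
  obtain ⟨k, hk, rfl⟩ := mem_map.1 ho
  obtain ⟨x, hx, e⟩ := hP k hk
  exact mem_image.2 ⟨x, hx, e⟩

/-- If `x` is joined to `a` in a color saturated at `a` and is also adjacent to `b`, then `bx`
repeats that color away from `a`, which is impossible. So these `x` are non-neighbors of `b`, and
`hS` leaves at most `#(sat b) - 2` of those. -/
theorem NoC4.card_satNbrs_le (hG : G.NoC4) (hS : ∀ v ∈ S, #S + 1 ≤ G.deg S v + #(G.sat S v))
    {k l : K} (hk : k ∈ G.sat S v) (hl : l ∈ G.sat S v)
    (hkl : k ≠ l) {a b : V} (ha : a ∈ S) (hb : b ∈ S) (hva : G.color v a = some k)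
    (hvb : G.color v b = some l) : #(G.satNbrs S a \ {v, b}) + 2 ≤ #(G.sat S b) := by
  have hab : a ≠ b := by rintro rfl; rw [hva] at hvb; exact hkl (Option.some.inj hvb)
  have h1 : G.satNbrs S a \ {v, b} ⊆ {x ∈ S.erase b | G.color b x = none} := by
    intro x hx
    simp only [satNbrs, mem_sdiff, mem_filter, mem_insert, mem_singleton, not_or] at hx
    obtain ⟨⟨hxS, m, hm, hax⟩, hxv, hxb⟩ := hx
    rw [mem_filter, mem_erase]
    refine ⟨⟨hxb, hxS⟩, ?_⟩
    by_contra hn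
    obtain ⟨q, hq⟩ := Option.ne_none_iff_exists'.1 hn
    have := hG.color_eq hk hl hkl ha hb hxS hva hvb hxv hax hq
    exact sat_not hm hb hxS hab.symm (ne_of_color hax).symm (this ▸ hq)
  have h2 := card_le_card h1
  have h3 := card_nonadj (G := G) hb
  have h4 := hS b hb
  omega

/-- The preceding bound for `(a, b)` and for `(b, a)` closes into a cycle of inequalities, all of
which must be equalities. Hence both `v` and `b` are needed to represent the saturated colors of
`a`, and with different colors. -/
theorem NoC4.sat_nbr (hG : G.NoC4) (hS : ∀ v ∈ S, #S + 1 ≤ G.deg S v + #(G.sat S v))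
    {k l : K} (hk : k ∈ G.sat S v) (hl : l ∈ G.sat S v)
    (hkl : k ≠ l) {a b : V} (ha : a ∈ S) (hb : b ∈ S) (hva : G.color v a = some k)
    (hvb : G.color v b = some l) :
    k ∈ G.sat S a ∧ ∃ m ∈ G.sat S a, m ≠ k ∧ G.color a b = some m := by
  have h1 := hG.card_satNbrs_le hS hk hl hkl ha hb hva hvb
  have h2 := hG.card_satNbrs_le hS hl hk hkl.symm hb ha hvb hva
  have key : ∀ x, G.satNbrs S x ⊆ S ∧ ∀ k ∈ G.sat S x, ∃ y ∈ G.satNbrs S x,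
      G.color x y = some k := by
    refine fun x => ⟨filter_subset _ _, fun k hk => ?_⟩
    obtain ⟨y, hy, e⟩ := exists_of_mem_sat hk
    exact ⟨y, by simp only [satNbrs, mem_filter]; exact ⟨hy, k, hk, e⟩, e⟩
  have hle : ∀ x y (P : Finset V), P ⊆ {v, y} → (∀ k ∈ G.sat S x, ∃ z ∈ (G.satNbrs S x \ {v, y}) ∪ P,
      G.color x z = some k) → #(G.sat S x) ≤ #(G.satNbrs S x \ {v, y}) + #P := fun x y P _ h =>
    (card_sat_le h).trans (card_union_le _ _)
  have hb' : #(G.sat S b) ≤ #(G.satNbrs S b \ {v, a}) + 2 :=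
    (hle b a {v, a} subset_rfl fun k hk => by
      obtain ⟨y, hy, e⟩ := (key b).2 k hk
      exact ⟨y, by simp [hy]; tauto, e⟩).trans (Nat.add_le_add_left card_le_two _)
  -- Replacing the pair `v`, `b` by one vertex `t` would save 1 in the cycle of inequalities and
  -- give `#(sat a) < #(sat a)`.
  have one : ∀ t, ¬ ∀ k ∈ G.sat S a, ∃ z ∈ (G.satNbrs S a \ {v, b}) ∪ {t},
      G.color a z = some k := fun t h => by
    have := (card_sat_le h).trans (card_union_le _ _)
    rw [card_singleton] at this
    omega
  have hv : v ∈ G.satNbrs S a := by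
    by_contra hv
    refine one b fun k hk => ?_
    obtain ⟨y, hy, e⟩ := (key a).2 k hk
    refine ⟨y, ?_, e⟩
    have : y ≠ v := fun h => hv (h ▸ hy)
    simp only [mem_union, mem_sdiff, mem_insert, mem_singleton]; tauto
  have hbm : b ∈ G.satNbrs S a := by
    by_contra hv
    refine one v fun k hk => ?_
    obtain ⟨y, hy, e⟩ := (key a).2 k hk
    refine ⟨y, ?_, e⟩
    have : y ≠ b := fun h => hv (h ▸ hy)
    simp only [mem_union, mem_sdiff, mem_insert, mem_singleton]; tauto
  obtain ⟨-, k', hk', e⟩ := mem_filter.1 hv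
  obtain ⟨-, m, hm, e'⟩ := mem_filter.1 hbm
  have : k' = k := by rw [color_comm hva] at e; exact (Option.some.inj e).symm
  subst this
  refine ⟨hk', m, hm, ?_, e'⟩
  rintro rfl
  refine one v fun l hl => ?_
  obtain ⟨y, hy, e''⟩ := (key a).2 l hl
  by_cases hyb : y = b
  · subst hyb
    rw [e'] at e''
    exact ⟨v, by simp, e.trans e''⟩
  · exact ⟨y, by simp only [mem_union, mem_sdiff, mem_insert, mem_singleton]; tauto, e''⟩

/-- A triangle through `v` in `S` whose three colors appear nowhere else. -/
theorem NoC4.exists_triangle (hG : G.NoC4) (hS : ∀ v ∈ S, #S + 1 ≤ G.deg S v + #(G.sat S v))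
    (hv : v ∈ S) : ∃ a ∈ S, ∃ b ∈ S, ∃ k l m, k ≠ l ∧ k ≠ m ∧ l ≠ m ∧
      G.color v a = some k ∧ G.color v b = some l ∧ G.color a b = some m ∧
      k ∈ G.sat S v ∧ k ∈ G.sat S a ∧ l ∈ G.sat S v ∧ l ∈ G.sat S b ∧ m ∈ G.sat S a ∧
      m ∈ G.sat S b ∧ #S ≤ G.deg S v + 1 := by
  have h2 : 1 < #(G.sat S v) := by
    have := hS v hv
    have := deg_lt (G := G) hv
    omega
  obtain ⟨k, hk, l, hl, hkl⟩ := one_lt_card.1 h2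
  obtain ⟨a, ha, hva⟩ := exists_of_mem_sat hk
  obtain ⟨b, hb, hvb⟩ := exists_of_mem_sat hl
  obtain ⟨hka, m, hma, hmk, hab⟩ := hG.sat_nbr hS hk hl hkl ha hb hva hvb
  obtain ⟨hlb, m', hmb, hml, hba⟩ := hG.sat_nbr hS hl hk hkl.symm hb ha hvb hva
  obtain rfl : m = m' := by rw [color_comm hab] at hba; exact Option.some.inj hba
  refine ⟨a, ha, b, hb, k, l, m, hkl, hmk.symm, hml.symm, hva, hvb, hab, hk, hka, hl, hlb, hma,
    hmb, ?_⟩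
  -- A third saturated color, on `vd`, would make the color of `ad` saturated at `a`, while
  -- `color_eq` repeats it on `bd`.
  suffices #(G.sat S v) ≤ 2 by have := hS v hv; omega
  refine (card_le_card (t := {k, l}) fun j hj => ?_).trans card_le_two
  by_contra hjkl
  simp only [mem_insert, mem_singleton, not_or] at hjkl
  obtain ⟨d, hd, hvd⟩ := exists_of_mem_sat hj
  obtain ⟨-, p, hp, -, had⟩ := hG.sat_nbr hS hk hj (Ne.symm hjkl.1) ha hd hva hvd
  obtain ⟨-, q, hq, -, hbd⟩ := hG.sat_nbr hS hl hj (Ne.symm hjkl.2) hb hd hvb hvd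
  have := hG.color_eq hk hl hkl ha hb hd hva hvb (ne_of_color hvd).symm had hbd
  exact sat_not hp hb hd (ne_of_color hab).symm (ne_of_color had).symm (this ▸ hbd)

/-- If deleting any vertex costs more than in the extremal graphs, the graph is a rainbow
triangle. -/
theorem NoC4.rainbow_triangle (hG : G.NoC4)
    (hS : ∀ v ∈ S, #S + 1 ≤ G.deg S v + #(G.sat S v)) (hv : v ∈ S) :
    ∃ a b k l m, k ≠ l ∧ k ≠ m ∧ l ≠ m ∧ G.color v a = some k ∧ G.color v b = some l ∧
      G.color a b = some m ∧ S = {v, a, b} := by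
  have hc : G.Complete S := fun x hx y hy hxy => by
    obtain ⟨-, -, -, -, -, -, -, -, -, -, -, -, -, -, -, -, -, -, -, h⟩ := hG.exists_triangle hS hx
    exact adj_of_deg hx h hy hxy.symm
  obtain ⟨a, ha, b, hb, k, l, m, hkl, hkm, hlm, hva, hvb, hab, hkv, hka, hlv, hlb, hma, hmb, -⟩ :=
    hG.exists_triangle hS hv
  refine ⟨a, b, k, l, m, hkl, hkm, hlm, hva, hvb, hab, ?_⟩
  by_contra hne
  have : ∃ w ∈ S, w ∉ ({v, a, b} : Finset V) := by
    by_contra! h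
    refine hne (subset_antisymm h ?_)
    simp [insert_subset_iff, hv, ha, hb]
  obtain ⟨w, hw, hwn⟩ := this
  simp only [mem_insert, mem_singleton, not_or] at hwn
  obtain ⟨hwv, hwa, hwb⟩ := hwn
  have hav := (ne_of_color hva).symm
  obtain ⟨a', ha', b', hb', k', l', m', hkl', hkm', hlm', hwa', hwb', hab', hkw', hka', hlw', hlb',
    hma', hmb', -⟩ := hG.exists_triangle hS hw
  -- This is `color_eq` seen from `b`, whose edges to `v` and `a` have saturated colors.
  have out : ∀ x ∈ S, x ≠ b → ∀ p q, G.color v x = some p → G.color a x = some q → p = q :=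
    fun x hx hxb p q => hG.color_eq hlb hmb hlm hv ha hx (color_comm hvb) (color_comm hab) hxb
  obtain ⟨X, hX⟩ := hc v hv w hw (Ne.symm hwv)
  obtain ⟨X', hX'⟩ := hc a ha w hw (Ne.symm hwa)
  obtain rfl := out w hw hwb X X' hX hX'
  -- The common color `X` of `vw` and `aw` is saturated at neither `v` nor `a`, so the private
  -- triangle of `w` avoids both.
  have nv : ∀ z j, G.color w z = some j → j ∈ G.sat S z → z ≠ v := by
    rintro z j h1 h2 rfl
    rw [color_comm hX] at h1
    exact sat_not h2 ha hw hav hwv (hX'.trans h1)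
  have na : ∀ z j, G.color w z = some j → j ∈ G.sat S z → z ≠ a := by
    rintro z j h1 h2 rfl
    rw [color_comm hX'] at h1
    exact sat_not h2 hv hw hav.symm hwa (hX.trans h1)
  have hva' := nv a' k' hwa' hka'
  have hvb' := nv b' l' hwb' hlb'
  have haa' := na a' k' hwa' hka'
  have hab'2 := na b' l' hwb' hlb'
  obtain ⟨Y, hY⟩ := hc a' ha' a ha haa'
  obtain rfl := hG.color_eq hlb' hmb' hlm' hw ha' ha (color_comm hwb') (color_comm hab') hab'2.symm
    (color_comm hX') hY
  -- The edge `aa'` also has color `X`, so the colors around this cycle are `k`, `X`, `k'`, `X`;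
  -- both `k` and `k'` differ from `X` because they are saturated.
  rcases hG v a a' w k X k' X hva'.symm (Ne.symm hwa) hva (color_comm hY) (color_comm hwa')
    (color_comm hX) with h | h | h | h
  · exact sat_not hkv ha hw hav hwv (h ▸ hX')
  · exact sat_not hkw' ha' ha (ne_of_color hwa').symm (Ne.symm hwa) (h ▸ hY)
  · exact sat_not hkw' ha' ha (ne_of_color hwa').symm (Ne.symm hwa) (h ▸ hY)
  · exact sat_not hkv ha hw hav hwv (h ▸ hX')

theorem cols_triangle {a b : V} {k l m : K} (hva : G.color v a = some k)
    (hvb : G.color v b = some l) (hab : G.color a b = some m) : G.cols {v, a, b} ⊆ {k, l, m} := by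
  intro j hj
  obtain ⟨x, hx, y, hy, e⟩ := mem_cols.1 hj
  have h1 := color_comm hva
  have h2 := color_comm hvb
  have h3 := color_comm hab
  simp only [mem_insert, mem_singleton] at hx hy ⊢
  rcases hx with rfl | rfl | rfl <;> rcases hy with rfl | rfl | rfl <;>
    simp_all [G.irrefl]

theorem NoC4.weight_le (hG : G.NoC4) (S : Finset V) : G.weight S ≤ #S * (#S + 1) := by
  induction S using Finset.strongInduction with
  | _ S ih =>
    by_contra! hlt
    have hS : ∀ v ∈ S, #S + 1 ≤ G.deg S v + #(G.sat S v) := fun v hv => by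
      have h1 := ih _ (erase_ssubset hv)
      rw [weight_erase hv] at hlt
      have h2 := card_erase_add_one hv
      rw [← h2] at hlt ⊢
      nlinarith
    rcases S.eq_empty_or_nonempty with rfl | ⟨v, hv⟩
    · simp [weight, cols] at hlt
    obtain ⟨a, b, k, l, m, hkl, hkm, hlm, hva, hvb, hab, rfl⟩ := hG.rainbow_triangle hS hv
    have h1 := sum_deg_le (G := G) (S := {v, a, b})
    have h2 := (card_le_card (cols_triangle hva hvb hab)).trans card_le_three
    have h3 : #({v, a, b} : Finset V) = 3 :=
      card_eq_three.2 ⟨v, a, b, ne_of_color hva, ne_of_color hvb, ne_of_color hab, rfl⟩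
    rw [h3] at h1 hlt
    rw [weight] at hlt
    omega

/-! ### The extremal configurations and their color counts -/

/-- All edges at `v` in `S` have the color `k`. -/
def Mono (G : PartialColoring V K) (S : Finset V) (v : V) (k : K) : Prop :=
  v ∈ S ∧ ∀ x ∈ S, x ≠ v → G.color v x = some k

/-- `uvw` is a dominating rainbow triangle of `S` with the colors `r`, `b`, `g` on `uv`, `vw`,
`uw`. -/
structure Dom (G : PartialColoring V K) (S : Finset V) (u v w : V) (r b g : K) : Prop where
  hu : u ∈ S
  hv : v ∈ S
  hw : w ∈ S
  rb : r ≠ b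
  bg : b ≠ g
  rg : r ≠ g
  uv : G.color u v = some r
  vw : G.color v w = some b
  uw : G.color u w = some g
  rest : ∀ x ∈ S, x ≠ u → x ≠ v → x ≠ w →
    G.color u x = some r ∧ G.color v x = some b ∧ G.color w x = some g

/-- The edges at `v` have distinct colors and all other edges have the color `k`. -/
structure Star (G : PartialColoring V K) (S : Finset V) (v : V) (k : K) : Prop where
  hv : v ∈ S
  adj : ∀ x ∈ S, x ≠ v → ∃ a, a ≠ k ∧ G.color v x = some a
  inj : ∀ x ∈ S, ∀ y ∈ S, ∀ a, G.color v x = some a → G.color v y = some a → x = y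
  rest : ∀ x ∈ S, ∀ y ∈ S, x ≠ v → y ≠ v → x ≠ y → G.color x y = some k

/-- One of the three extremal configurations occurs in `S`. -/
def HasType (G : PartialColoring V K) (S : Finset V) : Prop :=
  (∃ v k, G.Mono S v k) ∨ (∃ u v w r b g, G.Dom S u v w r b g) ∨ ∃ v k, G.Star S v k

theorem NoC4.card_cols_le (hG : G.NoC4) (h : G.Complete S) : #(G.cols S) ≤ #S := by
  have h1 := h.weight_eq
  have h2 := hG.weight_le S
  nlinarith

theorem Complete.weight_eq' (h : G.Complete S) (hc : #(G.cols S) = #S) :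
    G.weight S = #S * (#S + 1) := by
  have h1 := h.weight_eq
  rw [hc] at h1
  linarith

theorem Complete.card_cols_eq (h : G.Complete S) (hw : G.weight S = #S * (#S + 1)) :
    #(G.cols S) = #S := by
  have h1 := h.weight_eq
  rw [hw] at h1
  nlinarith

/-- One or two vertices span fewer edges than vertices, hence too few colors. -/
theorem three_le_card (hn : S.Nonempty) (hc : #(G.cols S) = #S) : 3 ≤ #S := by
  have h0 := hn.card_pos
  by_contra! h
  interval_cases hS : #S
  · obtain ⟨a, rfl⟩ := card_eq_one.1 hS
    obtain ⟨k, hk⟩ := card_pos.1 (by omega : 0 < #(G.cols {a}))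
    obtain ⟨x, hx, y, hy, e⟩ := mem_cols.1 hk
    exact ne_of_color e ((mem_singleton.1 hx).trans (mem_singleton.1 hy).symm)
  · obtain ⟨a, b, hab, rfl⟩ := card_eq_two.1 hS
    have : G.cols {a, b} ⊆ (G.color a b).toFinset := by
      intro k hk
      obtain ⟨x, hx, y, hy, e⟩ := mem_cols.1 hk
      have hxy := ne_of_color e
      simp only [mem_insert, mem_singleton] at hx hy
      rw [Option.mem_toFinset, Option.mem_def]
      rcases hx with rfl | rfl <;> rcases hy with rfl | rfl
      · exact absurd rfl hxy
      · exact e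
      · exact color_comm e
      · exact absurd rfl hxy
    have := card_le_card this
    have h1 : #(G.color a b).toFinset ≤ 1 := by cases G.color a b <;> simp
    omega

theorem mem_cols_erase {k : K} (hk : k ∈ G.cols S) (v : V) :
    k ∈ G.cols (S.erase v) ∨ ∃ x ∈ S, x ≠ v ∧ G.color v x = some k := by
  by_cases h : k ∈ G.cols (S.erase v)
  · exact Or.inl h
  · obtain ⟨x, hx, e⟩ := exists_of_mem_sat (mem_sdiff.2 ⟨hk, h⟩)
    exact Or.inr ⟨x, hx, (ne_of_color e).symm, e⟩

theorem Mono.cols_subset {k : K} (h : G.Mono S v k) :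
    G.cols S ⊆ insert k (G.cols (S.erase v)) := by
  intro j hj
  rcases mem_cols_erase hj v with h' | ⟨x, hx, hxv, e⟩
  · exact mem_insert_of_mem h'
  · rw [h.2 x hx hxv] at e
    simp [Option.some.inj e]

/-- Deleting `v` loses at most one color, and what remains has at most as many colors as vertices;
both bounds must be tight. -/
theorem NoC4.mono_cols (hG : G.NoC4) (hc : G.Complete S) (hn : #(G.cols S) = #S) {k : K}
    (h : G.Mono S v k) :
    #(G.cols (S.erase v)) = #(S.erase v) ∧ k ∉ G.cols (S.erase v) := by
  have h1 := hG.card_cols_le (hc.mono (erase_subset v S))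
  have h2 := card_erase_add_one h.1
  have h3 := card_le_card h.cols_subset
  have h4 := card_insert_le k (G.cols (S.erase v))
  refine ⟨by omega, fun hk => ?_⟩
  rw [insert_eq_self.2 hk] at h3
  omega

theorem Dom.rotate {u w : V} {r b g : K} (h : G.Dom S u v w r b g) : G.Dom S v w u b g r where
  hu := h.hv
  hv := h.hw
  hw := h.hu
  rb := h.bg
  bg := h.rg.symm
  rg := h.rb.symm
  uv := h.vw
  vw := color_comm h.uw
  uw := color_comm h.uv
  rest := fun x hx h1 h2 h3 => by
    obtain ⟨h4, h5, h6⟩ := h.rest x hx h3 h1 h2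
    exact ⟨h5, h6, h4⟩

theorem Dom.cols_subset {u w : V} {r b g : K} (h : G.Dom S u v w r b g) :
    G.cols S ⊆ {r, b, g} ∪ G.cols (S \ {u, v, w}) := by
  have key : ∀ {u v w r b g}, G.Dom S u v w r b g → ∀ y ∈ S, ∀ k, G.color u y = some k →
      k ∈ ({r, b, g} : Finset K) := by
    intro u v w r b g h y hy k e
    have hyu := (ne_of_color e).symm
    by_cases hyv : y = v
    · subst hyv; rw [h.uv] at e; simp [Option.some.inj e]
    by_cases hyw : y = w
    · subst hyw; rw [h.uw] at e; simp [Option.some.inj e]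
    rw [(h.rest y hy hyu hyv hyw).1] at e; simp [Option.some.inj e]
  have key' : ∀ x ∈ S, x ∈ ({u, v, w} : Finset V) → ∀ y ∈ S, ∀ k, G.color x y = some k →
      k ∈ ({r, b, g} : Finset K) := by
    intro x _ hx y hy k e
    simp only [mem_insert, mem_singleton] at hx
    rcases hx with rfl | rfl | rfl
    · exact key h y hy k e
    · have := key h.rotate y hy k e
      simp only [mem_insert, mem_singleton] at this ⊢; tauto
    · have := key h.rotate.rotate y hy k e
      simp only [mem_insert, mem_singleton] at this ⊢; tauto
  intro k hk
  obtain ⟨x, hx, y, hy, e⟩ := mem_cols.1 hk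
  rw [mem_union]
  by_cases hxm : x ∈ ({u, v, w} : Finset V)
  · exact Or.inl (key' x hx hxm y hy k e)
  by_cases hym : y ∈ ({u, v, w} : Finset V)
  · exact Or.inl (key' y hy hym x hx k (color_comm e))
  · exact Or.inr (mem_cols.2 ⟨x, mem_sdiff.2 ⟨hx, hxm⟩, y, mem_sdiff.2 ⟨hy, hym⟩, e⟩)

theorem Dom.card_sdiff {u w : V} {r b g : K} (h : G.Dom S u v w r b g) :
    #(S \ {u, v, w}) + 3 = #S := by
  have h3 : #({u, v, w} : Finset V) = 3 :=
    card_eq_three.2 ⟨u, v, w, ne_of_color h.uv, ne_of_color h.uw, ne_of_color h.vw, rfl⟩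
  rw [← h3]
  exact card_sdiff_add_card_eq_card (by simp [insert_subset_iff, h.hu, h.hv, h.hw])

theorem NoC4.dom_cols (hG : G.NoC4) (hc : G.Complete S) (hn : #(G.cols S) = #S) {u w : V}
    {r b g : K} (h : G.Dom S u v w r b g) :
    #(G.cols (S \ {u, v, w})) = #(S \ {u, v, w}) ∧ ∀ k ∈ ({r, b, g} : Finset K),
      k ∉ G.cols (S \ {u, v, w}) := by
  have h1 := hG.card_cols_le (hc.mono (sdiff_subset (s := S) (t := {u, v, w})))
  have h2 := h.card_sdiff
  have h3 := card_le_card h.cols_subset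
  have h4 := card_union_add_card_inter {r, b, g} (G.cols (S \ {u, v, w}))
  have h5 := card_le_three (a := r) (b := b) (c := g)
  refine ⟨by omega, fun k hk hk' => ?_⟩
  have := card_pos.2 ⟨k, mem_inter.2 ⟨hk, hk'⟩⟩
  omega

/-- A bare rainbow triangle is of type (3) as well, so the case with nothing outside the triangle
can be handed to the star arguments. -/
theorem Dom.star {u w : V} {r b g : K} (h : G.Dom S u v w r b g) (hS : S \ {u, v, w} = ∅) :
    G.Star S u b := by
  have hm : ∀ x ∈ S, x = u ∨ x = v ∨ x = w := fun x hx => by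
    simpa using sdiff_eq_empty_iff_subset.1 hS hx
  refine ⟨h.hu, fun x hx hxu => ?_, fun x hx y hy a ha hb => ?_, fun x hx y hy hxu hyu hxy => ?_⟩
  · rcases hm x hx with rfl | rfl | rfl
    · exact absurd rfl hxu
    · exact ⟨r, h.rb, h.uv⟩
    · exact ⟨g, h.bg.symm, h.uw⟩
  · have h1 := h.uv
    have h2 := h.uw
    have h3 := h.rg
    have h4 := G.irrefl u
    rcases hm x hx with rfl | rfl | rfl <;> rcases hm y hy with rfl | rfl | rfl <;> simp_all
  · have h1 := h.vw
    have h2 := color_comm h.vw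
    rcases hm x hx with rfl | rfl | rfl <;> rcases hm y hy with rfl | rfl | rfl <;> simp_all

/-! ### Adding a vertex to an extremal complete graph -/

/-- `S` has extremal weight, as has its complete subgraph `S.erase v`. -/
structure Extension (G : PartialColoring V K) (S : Finset V) (v : V) : Prop where
  noC4 : G.NoC4
  mem : v ∈ S
  weight : G.weight S = #S * (#S + 1)
  ih : ∀ T ⊂ S, G.weight T = #T * (#T + 1) → G.Complete T
  complete : G.Complete (S.erase v)
  cols : #(G.cols (S.erase v)) = #(S.erase v)
  card : 3 ≤ #(S.erase v)

theorem NoC4.card_le (hG : G.NoC4) (hw : G.weight S = #S * (#S + 1)) {u : V} (hu : u ∈ S) :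
    #S ≤ G.deg S u + #(G.sat S u) := by
  have h1 := hG.weight_le (S.erase u)
  have h2 := card_erase_add_one hu
  have h3 := weight_erase (G := G) hu
  rw [hw, ← h2] at h3
  rw [← h2]
  nlinarith

namespace Extension

variable (E : G.Extension S v)
include E

theorem deg_of_sat {u : V} (hu : u ∈ S) {α : K} (h : G.sat S u ⊆ {α}) :
    #S ≤ G.deg S u + 1 ∧ α ∈ G.sat S u := by
  have h1 := E.noC4.card_le E.weight hu
  have h2 := card_le_card h
  have h3 := deg_lt (G := G) hu
  rw [card_singleton] at h2
  refine ⟨by omega, ?_⟩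
  obtain ⟨k, hk⟩ := card_pos.1 (by omega : 0 < #(G.sat S u))
  exact mem_singleton.1 (h hk) ▸ hk

/-- Here `u` has full degree and exactly one saturated color, so deleting it costs exactly `2 * #S`;
the rest is extremal, hence complete by `ih`. -/
theorem complete_of_sat {u : V} (hu : u ∈ S) {α : K} (h : G.sat S u ⊆ {α}) : G.Complete S := by
  have h0 := (E.deg_of_sat hu h).1
  have h1 := E.noC4.weight_le (S.erase u)
  have h2 := card_erase_add_one hu
  have h3 := weight_erase (G := G) hu
  have h4 := deg_lt (G := G) hu
  have h5 := card_le_card h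
  rw [card_singleton] at h5
  have h6 := E.ih (S.erase u) (erase_ssubset hu) (by
    rw [E.weight, ← h2] at h3
    rw [← h2] at h4
    nlinarith)
  intro x hx y hy hxy
  by_cases hxu : x = u
  · exact hxu ▸ adj_of_deg hu h0 hy (fun h => hxy (hxu.trans h.symm))
  by_cases hyu : y = u
  · obtain ⟨k, hk⟩ := adj_of_deg hu h0 hx hxu
    exact ⟨k, hyu ▸ color_comm hk⟩
  · exact h6 x (mem_erase.2 ⟨hxu, hx⟩) y (mem_erase.2 ⟨hyu, hy⟩) hxy

theorem exists_new : ∃ β ∈ G.sat S v, ∃ x ∈ S.erase v, G.color v x = some β := by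
  have h1 := E.noC4.card_le E.weight E.mem
  have h3 := deg_lt (G := G) E.mem
  obtain ⟨k, hk⟩ := card_pos.1 (by omega : 0 < #(G.sat S v))
  obtain ⟨x, hx, e⟩ := exists_of_mem_sat hk
  exact ⟨k, hk, x, mem_erase.2 ⟨(ne_of_color e).symm, hx⟩, e⟩

theorem new_ne {β : K} (hβ : β ∈ G.sat S v) {x y : V} (hx : x ∈ S.erase v)
    (hy : y ∈ S.erase v) : G.color x y ≠ some β :=
  sat_not hβ (mem_of_mem_erase hx) (mem_of_mem_erase hy) (ne_of_mem_erase hx) (ne_of_mem_erase hy)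

theorem sat_subset {β : K} (h : ∀ x ∈ S.erase v, ∀ k ∈ G.sat S v, G.color v x = some k → k = β) :
    G.sat S v ⊆ {β} := fun k hk => by
  obtain ⟨x, hx, e⟩ := exists_of_mem_sat hk
  exact mem_singleton.2 (h x (mem_erase.2 ⟨(ne_of_color e).symm, hx⟩) k hk e)

/-- A vertex with a single saturated color is adjacent to all other vertices. -/
theorem adj {u : V} (hu : u ∈ S) {α : K} (h : G.sat S u ⊆ {α}) {x : V} (hx : x ∈ S)
    (hxu : x ≠ u) : ∃ k, G.color u x = some k :=
  adj_of_deg hu (E.deg_of_sat hu h).1 hx hxu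

/-- If `α` is the only saturated color of `u` that can appear on an edge of `S.erase v`, then `u` is
adjacent to `v`. -/
theorem adj_of_forall {u : V} (hu : u ∈ S.erase v) {α : K}
    (h : ∀ x ∈ S.erase v, ∀ k ∈ G.sat S u, G.color u x = some k → k = α) :
    ∃ k, G.color v u = some k := by
  have huS := mem_of_mem_erase hu
  by_contra hn
  have : G.sat S u ⊆ {α} := fun k hk => by
    obtain ⟨x, hx, e⟩ := exists_of_mem_sat hk
    refine mem_singleton.2 (h x (mem_erase.2 ⟨?_, hx⟩) k hk e)
    rintro rfl
    exact hn ⟨k, color_comm e⟩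
  obtain ⟨k, hk⟩ := E.adj huS this E.mem (ne_of_mem_erase hu).symm
  exact hn ⟨k, color_comm hk⟩

theorem of_mono {u : V} {α : K} (hu : G.Mono (S.erase v) u α) : G.Complete S ∧ G.HasType S := by
  obtain ⟨huH, hα⟩ := id hu
  have huS := mem_of_mem_erase huH
  have huv := ne_of_mem_erase huH
  obtain ⟨hJ, hαJ⟩ := E.noC4.mono_cols E.complete E.cols hu
  set J := (S.erase v).erase u with hJdef
  have hJm : ∀ {x}, x ∈ J ↔ x ≠ u ∧ x ≠ v ∧ x ∈ S := by simp [hJdef]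
  have hJ3 : 3 ≤ #J := by
    refine three_le_card (G := G) ?_ hJ
    have := card_erase_add_one huH
    rw [← hJdef] at this
    have := E.card
    exact card_pos.1 (by omega)
  obtain ⟨β, hβ⟩ := E.adj_of_forall huH (α := α) fun x hx k _ e => by
    rw [hα x hx (ne_of_color e).symm] at e; exact (Option.some.inj e).symm
  have hne : ∀ y, ∃ x ∈ J, x ≠ y := fun y => by
    obtain ⟨x, hx⟩ := card_pos.1 (by have := pred_card_le_card_erase (s := J) (a := y); omega :
      0 < #(J.erase y))
    exact ⟨x, mem_of_mem_erase hx, ne_of_mem_erase hx⟩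
  have hall : ∀ x ∈ S, x = v ∨ x = u ∨ x ∈ J := fun x hx => by rw [hJm]; tauto
  by_cases hβα : β = α
  · subst hβα
    have hm : G.Mono S u β := ⟨huS, fun x hx hxu => by
      by_cases hxv : x = v
      · exact hxv ▸ color_comm hβ
      · exact hα x (mem_erase.2 ⟨hxv, hx⟩) hxu⟩
    refine ⟨E.complete_of_sat huS (α := β) fun k hk => ?_, Or.inl ⟨u, β, hm⟩⟩
    obtain ⟨x, hx, e⟩ := exists_of_mem_sat hk
    rw [hm.2 x hx (ne_of_color e).symm] at e
    exact mem_singleton.2 (Option.some.inj e).symm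
  -- The cycle `v u x y` has colors `β`, `α`, `color x y`, `j`, and `α` does not occur inside `J`.
  have hF : ∀ y ∈ J, ∀ j, G.color v y = some j → j ≠ β → ∀ x ∈ J, x ≠ y →
      G.color y x = some j := by
    intro y hy j hj hjβ x hx hxy
    obtain ⟨hxu, hxv, hxS⟩ := hJm.1 hx
    obtain ⟨hyu, hyv, hyS⟩ := hJm.1 hy
    obtain ⟨r, hr⟩ := E.complete x (mem_erase.2 ⟨hxv, hxS⟩) y (mem_erase.2 ⟨hyv, hyS⟩) hxy
    rcases E.noC4 v u x y β α r j hxv.symm hyu.symm hβ (hα x (mem_erase.2 ⟨hxv, hxS⟩) hxu) hr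
      (color_comm hj) with h | h | h | h
    · exact absurd h hβα
    · exact absurd (mem_cols.2 ⟨x, hx, y, hy, h ▸ hr⟩) hαJ
    · exact h ▸ color_comm hr
    · exact absurd h hjβ
  -- Two exceptional vertices would both be monochromatic in `J` in the color of their common edge;
  -- but that color must vanish from `J` once one of them is deleted.
  have hU : ∀ y ∈ J, ∀ y' ∈ J, ∀ j j', G.color v y = some j → j ≠ β → G.color v y' = some j' →
      j' ≠ β → y = y' := by
    intro y hy y' hy' j j' hj hjβ hj' hjβ'
    by_contra hyy
    have h1 := hF y hy j hj hjβ
    have h2 := hF y' hy' j' hj' hjβ'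
    obtain rfl : j = j' := by
      have := h1 y' hy' (Ne.symm hyy)
      rw [color_comm (h2 y hy hyy)] at this
      exact (Option.some.inj this).symm
    have hm1 : G.Mono J y j := ⟨hy, h1⟩
    have hy'J : y' ∈ J.erase y := mem_erase.2 ⟨Ne.symm hyy, hy'⟩
    have hcJ : G.Complete J := E.complete.mono (erase_subset _ _)
    have hj := (E.noC4.mono_cols hcJ hJ hm1).2
    obtain ⟨z, hz⟩ : ∃ z, z ∈ (J.erase y).erase y' := card_pos.1 (by
      rw [card_erase_of_mem hy'J, card_erase_of_mem hy]; omega)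
    obtain ⟨hzy', hz⟩ := mem_erase.1 hz
    exact hj (mem_cols.2 ⟨y', hy'J, z, hz, h2 z (mem_of_mem_erase hz) hzy'⟩)
  have hsat : G.sat S v ⊆ {β} := E.sat_subset fun y hy k hk e => by
    by_contra hkβ
    by_cases hyu : y = u
    · subst hyu
      rw [hβ] at e
      exact hkβ (Option.some.inj e).symm
    have hyJ : y ∈ J := mem_erase.2 ⟨hyu, hy⟩
    obtain ⟨x, hx, hxy⟩ := hne y
    exact E.new_ne hk hy (mem_of_mem_erase hx) (hF y hyJ k e hkβ x hx hxy)
  have hC := E.complete_of_sat E.mem hsat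
  refine ⟨hC, ?_⟩
  by_cases hex : ∃ y ∈ J, G.color v y ≠ some β
  · obtain ⟨y, hy, hyβ⟩ := hex
    obtain ⟨hyu, hyv, hyS⟩ := hJm.1 hy
    obtain ⟨j, hj⟩ := hC v E.mem y hyS hyv.symm
    have hjβ : j ≠ β := fun h => hyβ (h ▸ hj)
    refine Or.inr (Or.inl ⟨v, u, y, β, α, j, E.mem, huS, hyS, hβα, ?_, hjβ.symm, hβ,
      hα y (mem_erase.2 ⟨hyv, hyS⟩) hyu, hj, fun x hx hxv hxu hxy => ?_⟩)
    · rintro rfl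
      obtain ⟨x, hx, hxy⟩ := hne y
      exact hαJ (mem_cols.2 ⟨y, hy, x, hx, hF y hy _ hj hjβ x hx hxy⟩)
    · have hxJ : x ∈ J := hJm.2 ⟨hxu, hxv, hx⟩
      refine ⟨?_, hα x (mem_erase.2 ⟨hxv, hx⟩) hxu, hF y hy j hj hjβ x hxJ hxy⟩
      obtain ⟨i, hi⟩ := hC v E.mem x hx (Ne.symm hxv)
      by_cases hiβ : i = β
      · exact hiβ ▸ hi
      · exact absurd (hU x hxJ y hy i j hi hiβ hj hjβ) hxy
  · push Not at hex
    refine Or.inl ⟨v, β, E.mem, fun x hx hxv => ?_⟩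
    rcases hall x hx with rfl | rfl | h
    · exact absurd rfl hxv
    · exact hβ
    · exact hex x h

theorem of_star {z : V} {k : K} (hz : G.Star (S.erase v) z k) : G.Complete S ∧ G.HasType S := by
  have hzS := mem_of_mem_erase hz.hv
  have hzv := ne_of_mem_erase hz.hv
  have hne : ∀ x, ∃ y ∈ S.erase v, y ≠ z ∧ y ≠ x := fun x => by
    obtain ⟨y, hy⟩ := card_pos.1 (by
      have h1 := pred_card_le_card_erase (s := S.erase v) (a := z)
      have h2 := pred_card_le_card_erase (s := (S.erase v).erase z) (a := x)
      have := E.card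
      omega : 0 < #(((S.erase v).erase z).erase x))
    simp only [mem_erase] at hy
    exact ⟨y, mem_erase.2 hy.2.2, hy.2.1, hy.1⟩
  have hvx : ∀ {x}, x ∈ S.erase v → v ≠ x := fun h => (ne_of_mem_erase h).symm
  obtain ⟨β, hβ, x, hx, hvx'⟩ := E.exists_new
  have hβ' : ∀ x ∈ S.erase v, ∀ y ∈ S.erase v, ∀ j, G.color x y = some j → j ≠ β :=
    fun x hx y hy j e h => E.new_ne hβ hx hy (h ▸ e)
  have hkβ : k ≠ β := by
    obtain ⟨x, hx, hxz, -⟩ := hne z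
    obtain ⟨y, hy, hyz, hyx⟩ := hne x
    exact hβ' x hx y hy k (hz.rest x hx y hy hxz hyz hyx.symm)
  -- If the new color is on the edge to the center, `v` becomes either a further leaf or a
  -- monochromatic vertex. Otherwise only four vertices are possible, and the star has a different
  -- center.
  by_cases hzβ : G.color v z = some β
  · have hleaf : ∀ x ∈ S.erase v, x ≠ z → ∀ j, G.color v x = some j → j = k ∨ j = β := by
      intro x hx hxz j hj
      obtain ⟨y, hy, hyz, hyx⟩ := hne x
      obtain ⟨a, hak, ha⟩ := hz.adj y hy hyz
      rcases E.noC4 v x y z j k a β (hvx hy) hxz hj (hz.rest x hx y hy hxz hyz hyx.symm)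
        (color_comm ha) (color_comm hzβ) with h | h | h | h
      · exact Or.inl h
      · exact absurd h.symm hak
      · exact absurd h (hβ' z hz.hv y hy a ha)
      · exact Or.inr h.symm
    have hsat : G.sat S v ⊆ {β} := E.sat_subset fun x hx j hj e => by
      by_cases hxz : x = z
      · subst hxz
        rw [hzβ] at e
        exact (Option.some.inj e).symm
      rcases hleaf x hx hxz j e with h | h
      · obtain ⟨y, hy, hyz, hyx⟩ := hne x
        exact absurd (hz.rest x hx y hy hxz hyz hyx.symm) (h ▸ E.new_ne hj hx hy)
      · exact h
    have hC := E.complete_of_sat E.mem hsat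
    refine ⟨hC, ?_⟩
    by_cases hex : ∃ x ∈ S.erase v, x ≠ z ∧ G.color v x ≠ some β
    · obtain ⟨x, hx, hxz, hxβ⟩ := hex
      have hxk : G.color v x = some k := by
        obtain ⟨j, hj⟩ := hC v E.mem x (mem_of_mem_erase hx) (hvx hx)
        rcases hleaf x hx hxz j hj with h | h
        · exact h ▸ hj
        · exact absurd (h ▸ hj) hxβ
      have hall : ∀ y ∈ S.erase v, y ≠ z → G.color v y = some k := by
        intro y hy hyz
        obtain ⟨j, hj⟩ := hC v E.mem y (mem_of_mem_erase hy) (hvx hy)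
        rcases hleaf y hy hyz j hj with h | h
        · exact h ▸ hj
        subst h
        have hxy : x ≠ y := by rintro rfl; exact hxβ hj
        obtain ⟨a, hak, ha⟩ := hz.adj x hx hxz
        obtain ⟨b, hbk, hb⟩ := hz.adj y hy hyz
        rcases E.noC4 v x z y k a b j hzv.symm hxy hxk (color_comm ha) hb (color_comm hj)
          with h | h | h | h
        · exact absurd h.symm hak
        · exact absurd (hz.inj x hx y hy a ha (h ▸ hb)) hxy
        · exact absurd h (hβ' z hz.hv y hy b hb)
        · exact absurd h.symm hkβ
      refine Or.inr (Or.inr ⟨z, k, hzS, fun y hy hyz => ?_, fun y hy w hw a h1 h2 => ?_,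
        fun y hy w hw hyz hwz hyw => ?_⟩)
      · by_cases hyv : y = v
        · exact ⟨β, hkβ.symm, hyv ▸ color_comm hzβ⟩
        · exact hz.adj y (mem_erase.2 ⟨hyv, hy⟩) hyz
      · have hc := color_comm hzβ
        by_cases hyv : y = v
        · by_cases hwv : w = v
          · exact hyv.trans hwv.symm
          · rw [hyv, hc] at h1
            exact absurd (Option.some.inj h1).symm
              (hβ' z hz.hv w (mem_erase.2 ⟨hwv, hw⟩) a h2)
        · by_cases hwv : w = v
          · rw [hwv, hc] at h2
            exact absurd (Option.some.inj h2).symm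
              (hβ' z hz.hv y (mem_erase.2 ⟨hyv, hy⟩) a h1)
          · exact hz.inj y (mem_erase.2 ⟨hyv, hy⟩) w (mem_erase.2 ⟨hwv, hw⟩) a h1 h2
      · by_cases hyv : y = v
        · subst hyv
          exact hall w (mem_erase.2 ⟨hyw.symm, hw⟩) hwz
        · by_cases hwv : w = v
          · subst hwv
            exact color_comm (hall y (mem_erase.2 ⟨hyv, hy⟩) hyz)
          · exact hz.rest y (mem_erase.2 ⟨hyv, hy⟩) w (mem_erase.2 ⟨hwv, hw⟩) hyz hwz hyw
    · push Not at hex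
      refine Or.inl ⟨v, β, E.mem, fun x hx hxv => ?_⟩
      by_cases hxz : x = z
      · exact hxz ▸ hzβ
      · exact hex x (mem_erase.2 ⟨hxv, hx⟩) hxz
  have hxz : x ≠ z := by rintro rfl; exact hzβ hvx'
  obtain ⟨a, hak, ha⟩ := hz.adj x hx hxz
  have haβ := hβ' z hz.hv x hx a ha
  have hleaf : ∀ y ∈ S.erase v, y ≠ z → y ≠ x → ∀ b, G.color z y = some b → ∀ j,
      G.color v y = some j → j = b ∨ j = β := by
    intro y hy hyz hyx b hb j hj
    rcases E.noC4 v x z y β a b j hzv.symm hyx.symm hvx' (color_comm ha) hb (color_comm hj)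
      with h | h | h | h
    · exact absurd h.symm haβ
    · exact absurd (hz.inj x hx y hy a ha (h ▸ hb)).symm hyx
    · exact Or.inl h.symm
    · exact Or.inr h
  have hcenter : ∀ y ∈ S.erase v, y ≠ z → y ≠ x → ∀ b, G.color z y = some b → ∀ t,
      G.color v z = some t → t = b := by
    intro y hy hyz hyx b hb t ht
    obtain ⟨b', hb'k, hb'⟩ := hz.adj y hy hyz
    obtain rfl : b' = b := Option.some.inj (hb'.symm.trans hb)
    rcases E.noC4 v x y z β k b' t (hvx hy) hxz hvx' (hz.rest x hx y hy hxz hyz hyx.symm)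
      (color_comm hb) (color_comm ht) with h | h | h | h
    · exact absurd h.symm hkβ
    · exact absurd h.symm hb'k
    · exact h.symm
    · exact absurd (h ▸ ht) hzβ
  have hsat : G.sat S v ⊆ {β} := E.sat_subset fun y hy j hj e => by
    by_cases hyx : y = x
    · subst hyx
      exact Option.some.inj (e.symm.trans hvx')
    by_cases hyz : y = z
    · subst hyz
      obtain ⟨w, hw, hwz, hwx⟩ := hne x
      obtain ⟨b, -, hb⟩ := hz.adj w hw hwz
      exact absurd hb (hcenter w hw hwz hwx b hb j e ▸ E.new_ne hj hy hw)
    · obtain ⟨b, -, hb⟩ := hz.adj y hy hyz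
      rcases hleaf y hy hyz hyx b hb j e with h | h
      · exact absurd hb (h ▸ E.new_ne hj hz.hv hy)
      · exact h
  have hC := E.complete_of_sat E.mem hsat
  refine ⟨hC, ?_⟩
  obtain ⟨y, hy, hyz, hyx⟩ := hne x
  obtain ⟨b, hbk, hb⟩ := hz.adj y hy hyz
  obtain ⟨t, ht⟩ := hC v E.mem z hzS hzv.symm
  obtain rfl := hcenter y hy hyz hyx b hb t ht
  have hat : a ≠ t := fun h => hyx (hz.inj x hx y hy a ha (h ▸ hb)).symm
  have htβ : t ≠ β := hβ' z hz.hv y hy t hb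
  have hxyk := hz.rest x hx y hy hxz hyz hyx.symm
  have hvy : G.color v y = some t := by
    obtain ⟨j, hj⟩ := hC v E.mem y (mem_of_mem_erase hy) (hvx hy)
    rcases hleaf y hy hyz hyx t hb j hj with h | h
    · exact h ▸ hj
    subst h
    rcases E.noC4 v y x z j k a t (hvx hx) hyz hj (color_comm hxyk) (color_comm ha)
      (color_comm ht) with h | h | h | h
    · exact absurd h.symm hkβ
    · exact absurd h.symm hak
    · exact absurd h hat
    · exact absurd h htβ
  -- By `hcenter`, every leaf other than `x` is joined to `z` in color `t`; the colors at `z` are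
  -- distinct, so `y` is the only such leaf.
  have hall : ∀ w ∈ S, w = v ∨ w = x ∨ w = y ∨ w = z := by
    intro w hw
    by_contra! h
    have hw' : w ∈ S.erase v := mem_erase.2 ⟨h.1, hw⟩
    obtain ⟨c, -, hc⟩ := hz.adj w hw' h.2.2.2
    have := hcenter w hw' h.2.2.2 h.2.1 c hc t ht
    exact h.2.2.1 (hz.inj w hw' y hy c hc (this ▸ hb))
  have hxv' := color_comm hvx'
  have hxz' := color_comm ha
  have hstar : ∀ w ∈ S, w ≠ x → ∃ a, a ≠ t ∧ G.color x w = some a := fun w hw hwx => by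
    rcases hall w hw with rfl | rfl | rfl | rfl
    · exact ⟨β, htβ.symm, hxv'⟩
    · exact absurd rfl hwx
    · exact ⟨k, hbk.symm, hxyk⟩
    · exact ⟨a, hat, hxz'⟩
  refine Or.inr (Or.inr ⟨x, t, mem_of_mem_erase hx, hstar, fun w hw u hu c h1 h2 => ?_,
    fun w hw u hu hwx hux hwu => ?_⟩)
  · have e := h1.trans h2.symm
    have hx0 := ne_of_color h1
    have hx1 := ne_of_color h2
    rcases hall w hw with rfl | rfl | rfl | rfl <;> rcases hall u hu with rfl | rfl | rfl | rfl <;>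
      first
      | rfl
      | exact absurd rfl hx0
      | exact absurd rfl hx1
      | simp [hxv', hxyk, hxz', hkβ, hkβ.symm, haβ, haβ.symm, hak, hak.symm] at e
  · have h1 := color_comm ht
    have h2 := color_comm hb
    have h3 := color_comm hvy
    rcases hall w hw with rfl | rfl | rfl | rfl <;> rcases hall u hu with rfl | rfl | rfl | rfl <;>
      first | assumption | exact absurd rfl hwx | exact absurd rfl hux | exact absurd rfl hwu

theorem dom_rest {p q r : V} {R B g : K} (h : G.Dom (S.erase v) p q r R B g)
    (hT : (S.erase v \ {p, q, r}).Nonempty) :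
    3 ≤ #(S.erase v \ {p, q, r}) ∧ ∀ k ∈ ({R, B, g} : Finset K), ∀ s ∈ S.erase v \ {p, q, r},
      ∀ t ∈ S.erase v \ {p, q, r}, G.color s t ≠ some k := by
  obtain ⟨h1, h2⟩ := E.noC4.dom_cols E.complete E.cols h
  exact ⟨three_le_card hT h1, fun k hk s hs t ht e => h2 k hk (mem_cols.2 ⟨s, hs, t, ht, e⟩)⟩

/-- The color `g` of `pr` also occurs from `r` to the vertices outside the triangle, so it is not
saturated at `p`. -/
theorem dom_sat {p q r : V} {R B g : K} (h : G.Dom (S.erase v) p q r R B g)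
    (hT : (S.erase v \ {p, q, r}).Nonempty) :
    ∀ x ∈ S.erase v, ∀ k ∈ G.sat S p, G.color p x = some k → k = R := by
  intro x hx k hk e
  have hxp := (ne_of_color e).symm
  by_cases hxq : x = q
  · subst hxq
    exact Option.some.inj (e.symm.trans h.uv)
  by_cases hxr : x = r
  · subst hxr
    obtain rfl := Option.some.inj (e.symm.trans h.uw)
    obtain ⟨t, ht⟩ := hT
    simp only [mem_sdiff, mem_insert, mem_singleton, not_or] at ht
    exact absurd (h.rest t ht.1 ht.2.1 ht.2.2.1 ht.2.2.2).2.2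
      (sat_not hk (mem_of_mem_erase hx) (mem_of_mem_erase ht.1) hxp ht.2.1)
  · exact Option.some.inj (e.symm.trans (h.rest x hx hxp hxq hxr).1)

theorem dom_adj {p q r : V} {R B g : K} (h : G.Dom (S.erase v) p q r R B g)
    (hT : (S.erase v \ {p, q, r}).Nonempty) : ∃ k, G.color v p = some k :=
  E.adj_of_forall h.hu (E.dom_sat h hT)

/-- The cycle `v p t q` with `t` outside the triangle settles everything but `k = R`, and then `v p
r q` does. -/
theorem dom_next {p q r : V} {R B g : K} (h : G.Dom (S.erase v) p q r R B g)
    (hT : (S.erase v \ {p, q, r}).Nonempty) {k l : K} (hp : G.color v p = some k)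
    (hq : G.color v q = some l) : l = B ∨ k = l := by
  obtain ⟨t, ht⟩ := hT
  simp only [mem_sdiff, mem_insert, mem_singleton, not_or] at ht
  obtain ⟨htp, htq, -⟩ := h.rest t ht.1 ht.2.1 ht.2.2.1 ht.2.2.2
  have hpq := ne_of_color h.uv
  rcases E.noC4 v p t q k R B l (ne_of_mem_erase ht.1).symm hpq hp htp (color_comm htq)
    (color_comm hq) with h1 | h1 | h1 | h1
  · rcases E.noC4 v p r q k g B l (ne_of_mem_erase h.hw).symm hpq hp h.uw (color_comm h.vw)
      (color_comm hq) with h2 | h2 | h2 | h2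
    · exact absurd (h1.symm.trans h2) h.rg
    · exact absurd h2.symm h.bg
    · exact Or.inl h2.symm
    · exact Or.inr h2.symm
  · exact absurd h1 h.rb
  · exact Or.inl h1.symm
  · exact Or.inr h1.symm

/-- One deviating color `δ` at `p` spreads: `dom_next` carries it to `r`, 4-cycles carry it to the
outside vertices. It is then the only color that can be saturated at `v`, which finally forces it on
`vq` and makes `v` monochromatic. -/
theorem dom_ne {p q r : V} {R B g : K} (h : G.Dom (S.erase v) p q r R B g)
    (hT : (S.erase v \ {p, q, r}).Nonempty) {δ : K} (hp : G.color v p = some δ) (hδ : δ ≠ R) :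
    G.Complete S ∧ G.HasType S := by
  obtain ⟨hT3, hTc⟩ := E.dom_rest h hT
  obtain ⟨l, hq⟩ := E.dom_adj h.rotate (by convert hT using 2; ext; simp; tauto)
  obtain ⟨m, hr⟩ := E.dom_adj h.rotate.rotate (by convert hT using 2; ext; simp; tauto)
  have hpq := E.dom_next h hT hp hq
  have hqr := E.dom_next h.rotate (by convert hT using 2; ext; simp; tauto) hq hr
  have hrp := E.dom_next h.rotate.rotate (by convert hT using 2; ext; simp; tauto) hr hp
  obtain rfl : m = δ := hrp.resolve_left hδ
  have hs : ∀ s ∈ S.erase v \ {p, q, r}, ∀ j, G.color v s = some j → j = m := by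
    intro s hs j hj
    have hs' := hs
    simp only [mem_sdiff, mem_insert, mem_singleton, not_or] at hs'
    obtain ⟨hsp, hsq, -⟩ := h.rest s hs'.1 hs'.2.1 hs'.2.2.1 hs'.2.2.2
    rcases E.noC4 v p q s m R B j (ne_of_mem_erase h.hv).symm (Ne.symm hs'.2.1) hp h.uv hsq
      (color_comm hj) with h1 | h1 | h1 | h1
    · exact absurd h1 hδ
    · exact absurd h1 h.rb
    · subst h1
      -- If `vs` has color `B`, a second outside vertex `t` gives the cycle `v p t s`; the color of
      -- `ts` is neither `R` nor `B`, so `B = δ`.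
      obtain ⟨t, ht, hts⟩ := exists_mem_ne (by omega : 1 < #(S.erase v \ {p, q, r})) s
      have ht' := ht
      simp only [mem_sdiff, mem_insert, mem_singleton, not_or] at ht'
      obtain ⟨htp, -, -⟩ := h.rest t ht'.1 ht'.2.1 ht'.2.2.1 ht'.2.2.2
      obtain ⟨c, hc⟩ := E.complete t ht'.1 s hs'.1 hts
      rcases E.noC4 v p t s m R c B (ne_of_mem_erase ht'.1).symm (Ne.symm hs'.2.1) hp htp hc
        (color_comm hj) with h2 | h2 | h2 | h2
      · exact absurd h2 hδ
      · exact absurd hc (hTc c (by simp [h2]) t ht s hs)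
      · exact absurd hc (hTc c (by simp [h2]) t ht s hs)
      · exact h2
    · exact h1
  have hall : ∀ x ∈ S.erase v, x = p ∨ x = q ∨ x = r ∨ x ∈ S.erase v \ {p, q, r} := by
    intro x hx
    simp only [mem_sdiff, mem_insert, mem_singleton]
    tauto
  have hsat : G.sat S v ⊆ {m} := E.sat_subset fun x hx j hj e => by
    rcases hall x hx with rfl | rfl | rfl | h'
    · exact Option.some.inj (e.symm.trans hp)
    · obtain rfl := Option.some.inj (e.symm.trans hq)
      rcases hpq with h1 | h1
      · exact absurd h.vw (h1 ▸ E.new_ne hj h.hv h.hw)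
      · exact h1.symm
    · exact Option.some.inj (e.symm.trans hr)
    · exact hs x h' j e
  have hC := E.complete_of_sat E.mem hsat
  have hm := (E.deg_of_sat E.mem hsat).2
  have hlm : l = m := by
    rcases hqr with h1 | h1
    · exact absurd h.uw (h1 ▸ E.new_ne hm h.hu h.hw)
    · exact h1
  refine ⟨hC, Or.inl ⟨v, m, E.mem, fun x hx hxv => ?_⟩⟩
  rcases hall x (mem_erase.2 ⟨hxv, hx⟩) with rfl | rfl | rfl | h'
  · exact hp
  · exact hlm ▸ hq
  · exact hr
  · obtain ⟨j, hj⟩ := hC v E.mem x hx (Ne.symm hxv)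
    exact hs x h' j hj ▸ hj

theorem of_dom {p q r : V} {R B g : K} (h : G.Dom (S.erase v) p q r R B g) :
    G.Complete S ∧ G.HasType S := by
  rcases (S.erase v \ {p, q, r}).eq_empty_or_nonempty with hT | hT
  · exact E.of_star (h.star hT)
  have hT' : (S.erase v \ {q, r, p}).Nonempty := by convert hT using 2; ext; simp; tauto
  have hT'' : (S.erase v \ {r, p, q}).Nonempty := by convert hT using 2; ext; simp; tauto
  obtain ⟨k, hp⟩ := E.dom_adj h hT
  obtain ⟨l, hq⟩ := E.dom_adj h.rotate hT'
  obtain ⟨m, hr⟩ := E.dom_adj h.rotate.rotate hT''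
  by_cases hk : k = R
  swap
  · exact E.dom_ne h hT hp hk
  by_cases hl : l = B
  swap
  · exact E.dom_ne h.rotate hT' hq hl
  by_cases hm : m = g
  swap
  · exact E.dom_ne h.rotate.rotate hT'' hr hm
  subst hk hl hm
  refine ⟨E.complete_of_sat (mem_of_mem_erase h.hu) (α := k) fun j hj => ?_, Or.inr (Or.inl
    ⟨p, q, r, k, l, m, mem_of_mem_erase h.hu, mem_of_mem_erase h.hv, mem_of_mem_erase h.hw, h.rb,
      h.bg, h.rg, h.uv, h.vw, h.uw, fun x hx hxp hxq hxr => ?_⟩)⟩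
  · obtain ⟨x, hx, e⟩ := exists_of_mem_sat hj
    by_cases hxv : x = v
    · subst hxv
      rw [color_comm hp] at e
      exact mem_singleton.2 (Option.some.inj e).symm
    · exact mem_singleton.2 (E.dom_sat h hT x (mem_erase.2 ⟨hxv, hx⟩) j hj e)
  · by_cases hxv : x = v
    · subst hxv
      exact ⟨color_comm hp, color_comm hq, color_comm hr⟩
    · exact h.rest x (mem_erase.2 ⟨hxv, hx⟩) hxp hxq hxr

end Extension

/-! ### The induction for extremal graphs -/

theorem rainbow_triangle_type {a b : V} {k l m : K} (hkl : k ≠ l) (hkm : k ≠ m) (hlm : l ≠ m)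
    (hva : G.color v a = some k) (hvb : G.color v b = some l) (hab : G.color a b = some m) :
    G.Complete {v, a, b} ∧ G.HasType {v, a, b} := by
  refine ⟨fun x hx y hy hxy => ?_, Or.inr (Or.inl ⟨v, a, b, k, m, l, by simp, by simp, by simp,
    hkm, hlm.symm, hkl, hva, hab, hvb, fun x hx h1 h2 h3 => ?_⟩)⟩
  · simp only [mem_insert, mem_singleton] at hx hy
    have h1 := color_comm hva
    have h2 := color_comm hvb
    have h3 := color_comm hab
    rcases hx with rfl | rfl | rfl <;> rcases hy with rfl | rfl | rfl <;>
      first | exact absurd rfl hxy | exact ⟨_, by assumption⟩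
  · simp only [mem_insert, mem_singleton] at hx
    tauto

theorem NoC4.extremal (hG : G.NoC4) (hn : S.Nonempty) (hw : G.weight S = #S * (#S + 1)) :
    G.Complete S ∧ G.HasType S := by
  induction S using Finset.strongInduction with
  | _ S ih =>
    by_cases hS : ∀ v ∈ S, #S + 1 ≤ G.deg S v + #(G.sat S v)
    · obtain ⟨v, hv⟩ := hn
      obtain ⟨a, b, k, l, m, hkl, hkm, hlm, hva, hvb, hab, rfl⟩ := hG.rainbow_triangle hS hv
      exact rainbow_triangle_type hkl hkm hlm hva hvb hab
    push Not at hS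
    obtain ⟨v, hv, hlt⟩ := hS
    have h1 := hG.card_le hw hv
    have h2 := card_erase_add_one hv
    -- Here `deg + sat` is exactly `#S`, so the weight drops from `n * (n + 1)` to `(n - 1) * n`.
    have hw' : G.weight (S.erase v) = #(S.erase v) * (#(S.erase v) + 1) := by
      have h3 := weight_erase (G := G) hv
      rw [hw, ← h2] at h3
      rw [← h2] at h1 hlt
      nlinarith
    have hn' : (S.erase v).Nonempty := by
      have h4 := deg_lt (G := G) hv
      obtain ⟨k, hk⟩ := card_pos.1 (by omega : 0 < #(G.sat S v))
      obtain ⟨x, hx, e⟩ := exists_of_mem_sat hk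
      exact ⟨x, mem_erase.2 ⟨(ne_of_color e).symm, hx⟩⟩
    obtain ⟨hC, hT⟩ := ih _ (erase_ssubset hv) hn' hw'
    have hcols := hC.card_cols_eq hw'
    have E : G.Extension S v := ⟨hG, hv, hw, fun T hT hwT => by
      rcases T.eq_empty_or_nonempty with rfl | hTn
      · intro x hx; simp at hx
      · exact (ih T hT hTn hwT).1, hC, hcols, three_le_card hn' hcols⟩
    rcases hT with ⟨u, k, h⟩ | ⟨u, w, x, r, b, g, h⟩ | ⟨z, k, h⟩
    · exact E.of_mono h
    · exact E.of_dom h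
    · exact E.of_star h

end PartialColoring

/-! ### Translation to edge labelings -/

namespace SimpleGraph.EdgeLabeling

variable {V K : Type*} {G : SimpleGraph V}

open Classical in
/-- The partial coloring of the pairs of vertices given by an edge labeling. -/
noncomputable def toPartialColoring (C : G.EdgeLabeling K) : PartialColoring V K where
  color x y := if h : G.Adj x y then some (C.get x y h) else none
  symm x y := by
    simp only [G.adj_comm x y]
    split_ifs with h
    · rw [C.get_comm]
    · rfl
  irrefl x := by simp

theorem labelGraph_adj_iff_color (C : G.EdgeLabeling K) {k : K} {x y : V} :
    (C.labelGraph k).Adj x y ↔ C.toPartialColoring.color x y = some k := by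
  simp only [labelGraph_adj, toPartialColoring]
  split_ifs with h <;> simp [h, EdgeLabeling.get]

theorem isSome_color (C : G.EdgeLabeling K) {x y : V} :
    (C.toPartialColoring.color x y).isSome ↔ G.Adj x y := by
  simp only [toPartialColoring]
  split_ifs with h <;> simp [h]

theorem noC4_of_not_hasProperlyColoredC4 (C : G.EdgeLabeling K)
    (h : ¬ C.HasProperlyColoredC4) : C.toPartialColoring.NoC4 := by
  intro a b x y p q r s hax hby h1 h2 h3 h4
  by_contra! hne
  simp only [← labelGraph_adj_iff_color] at h1 h2 h3 h4
  exact h ⟨a, b, x, y, hax, hby, p, q, r, s, h1, h2, h3, h4, hne⟩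

variable [DecidableEq V] [DecidableEq K]

theorem numColorsOn_eq (C : G.EdgeLabeling K) (S : Finset V) :
    C.numColorsOn (S : Set V) = #(C.toPartialColoring.cols S) := by
  rw [numColorsOn, ← Set.ncard_coe_finset]
  congr 1
  ext k
  simp [PartialColoring.mem_cols, labelGraph_adj_iff_color]

theorem numColors_eq [Fintype V] (C : G.EdgeLabeling K) :
    C.numColors = #(C.toPartialColoring.cols univ) := by
  rw [numColors, ← Set.ncard_coe_finset]
  congr 1
  ext k
  simp only [Set.mem_ofPred_eq, mem_coe, PartialColoring.mem_cols, mem_univ, true_and,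
    ← labelGraph_adj_iff_color, labelGraph_adj]
  constructor
  · rintro ⟨⟨e, he⟩, rfl⟩
    induction e with
    | _ x y => exact ⟨x, y, he, rfl⟩
  · rintro ⟨x, y, h, rfl⟩
    exact ⟨⟨s(x, y), h⟩, rfl⟩

theorem weight_univ [Fintype V] (C : G.EdgeLabeling K) :
    C.toPartialColoring.weight univ = 2 * (G.edgeSet.ncard + C.numColors) := by
  classical
  rw [PartialColoring.weight, numColors_eq, ← coe_edgeFinset, Set.ncard_coe_finset, mul_add,
    ← G.sum_degrees_eq_twice_card_edges]
  congr 1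
  refine sum_congr rfl fun x _ => ?_
  rw [PartialColoring.deg, ← card_neighborFinset_eq_degree]
  congr 1
  ext y
  simp [isSome_color]

theorem isMonochromaticVertex_of_mono {C : G.EdgeLabeling K} {S : Finset V} {v : V} {k : K}
    (h : C.toPartialColoring.Mono S v k) : C.IsMonochromaticVertex S v :=
  ⟨h.1, k, fun x hx hxv => (C.labelGraph_adj_iff_color).2 (h.2 x hx hxv)⟩

theorem isDominatingRainbowTriangle_of_dom {C : G.EdgeLabeling K} {S : Finset V} {u v w : V}
    {r b g : K} (h : C.toPartialColoring.Dom S u v w r b g) :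
    C.IsDominatingRainbowTriangle S u v w := by
  refine ⟨h.hu, h.hv, h.hw, r, b, g, h.rb, h.bg, h.rg, ?_⟩
  simp only [labelGraph_adj_iff_color]
  exact ⟨h.uv, h.vw, h.uw, h.rest⟩

theorem isRainbowStarCenter_of_star {C : G.EdgeLabeling K} {S : Finset V} {v : V} {k : K}
    (h : C.toPartialColoring.Star S v k) : C.IsRainbowStarCenter S v := by
  refine ⟨h.hv, k, ?_⟩
  simp only [labelGraph_adj_iff_color]
  exact ⟨h.adj, h.inj, h.rest⟩

theorem isLayered_of_extremal {C : G.EdgeLabeling K} (hC : C.toPartialColoring.NoC4)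
    {S : Finset V} (hn : S.Nonempty) (hS : C.toPartialColoring.Complete S)
    (hc : #(C.toPartialColoring.cols S) = #S) : C.IsLayered (S : Set V) := by
  induction S using Finset.strongInduction with
  | _ S ih =>
    have hcard : C.numColorsOn (S : Set V) = (S : Set V).ncard := by
      rw [numColorsOn_eq, Set.ncard_coe_finset, hc]
    have h3 := PartialColoring.three_le_card hn hc
    rcases (hC.extremal hn (hS.weight_eq' hc)).2 with
      ⟨u, k, h⟩ | ⟨u, v, w, r, b, g, h⟩ | ⟨z, k, h⟩
    · refine IsLayered.vertex _ u hcard (isMonochromaticVertex_of_mono h) ?_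
      rw [← coe_erase]
      refine ih _ (erase_ssubset h.1) (card_pos.1 ?_) (hS.mono (erase_subset _ _))
        (hC.mono_cols hS hc h).1
      have := card_erase_add_one h.1
      omega
    -- The layering must end in a star, never in the empty set, so a triangle with nothing outside
    -- counts as the center.
    · rcases (S \ {u, v, w}).eq_empty_or_nonempty with he | hne
      · exact IsLayered.center _ u hcard (isRainbowStarCenter_of_star (h.star he))
      · refine IsLayered.triangle _ u v w hcard (isDominatingRainbowTriangle_of_dom h) ?_
        have := ih (S \ {u, v, w}) ?_ hne (hS.mono sdiff_subset) (hC.dom_cols hS hc h).1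
        · simpa only [coe_sdiff, coe_insert, coe_singleton] using this
        · refine ssubset_of_subset_of_ne sdiff_subset fun e => ?_
          have := h.card_sdiff
          rw [e] at this
          omega
    · exact IsLayered.center _ z hcard (isRainbowStarCenter_of_star h)

end SimpleGraph.EdgeLabeling

theorem theorem6 {V K : Type*} [Fintype V] [Nonempty V] (G : SimpleGraph V)
    (C : G.EdgeLabeling K) (n : ℕ) (hn : Fintype.card V = n) :
    (n * (n + 1) / 2 + 1 ≤ G.edgeSet.ncard + C.numColors → C.HasProperlyColoredC4) ∧
    (G.edgeSet.ncard + C.numColors = n * (n + 1) / 2 → ¬ C.HasProperlyColoredC4 →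
      G = ⊤ ∧
      ((∃ v, C.IsMonochromaticVertex Set.univ v) ∨
        (∃ u v w, C.IsDominatingRainbowTriangle Set.univ u v w) ∨
        (∃ v, C.IsRainbowStarCenter Set.univ v)) ∧
      C.IsLayered Set.univ) := by
  classical
  have hw := C.weight_univ
  have hcard : #(univ : Finset V) = n := by rw [card_univ, hn]
  -- Since `n * (n + 1)` is even, the truncated division in the statement is exact.
  have hpar := Nat.div_mul_cancel (Nat.even_mul_succ_self n).two_dvd
  refine ⟨fun h => ?_, fun h hC4 => ?_⟩
  · by_contra hC4
    have := (C.noC4_of_not_hasProperlyColoredC4 hC4).weight_le univ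
    rw [hcard] at this
    omega
  · have hC := C.noC4_of_not_hasProperlyColoredC4 hC4
    have hw' : C.toPartialColoring.weight univ = #(univ : Finset V) * (#(univ : Finset V) + 1) := by
      rw [hcard]; omega
    obtain ⟨hS, hT⟩ := hC.extremal univ_nonempty hw'
    refine ⟨?_, ?_, ?_⟩
    · ext x y
      refine ⟨fun h => h.ne, fun h => C.isSome_color.1 ?_⟩
      obtain ⟨k, hk⟩ := hS x (mem_univ _) y (mem_univ _) h
      simp [hk]
    · rw [← coe_univ]
      rcases hT with ⟨u, k, h⟩ | ⟨u, v, w, r, b, g, h⟩ | ⟨z, k, h⟩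
      · exact Or.inl ⟨u, SimpleGraph.EdgeLabeling.isMonochromaticVertex_of_mono h⟩
      · exact Or.inr (Or.inl
          ⟨u, v, w, SimpleGraph.EdgeLabeling.isDominatingRainbowTriangle_of_dom h⟩)
      · exact Or.inr (Or.inr ⟨z, SimpleGraph.EdgeLabeling.isRainbowStarCenter_of_star h⟩)
    · rw [← coe_univ]
      exact SimpleGraph.EdgeLabeling.isLayered_of_extremal hC univ_nonempty hS
        (hS.card_cols_eq hw')
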